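/- Let $d\ge 1$. For $r>0$ let $\mathcal E_o(r)$ be the space of smooth tempered distributions (functions) $f$ on $\mathbb R^d$ whose Fourier transform $\widehat f(\xi)=\int f(x)e^{-i\langle x,\xi\rangle}dx$ is supported in the annulus $\{\xi: r/2\le|\xi|\le r\}$. For $r>0$ and $\sigma\ge 0$ let $$\mathfrak M_{\sigma,r}g(x)=\sup_{y\in\mathbb R^d}\frac{|g(x+y)|}{(1+r|y|)^\sigma}$$ be the Peetre maximal function. Suppose $0<q\le p<\infty$ and $0\le\sigma\le d/q$. Quasinorms $\|\cdot\|_p=\|\cdot\|_{L^p(\mathbb R^d)}$ are allowed to take the value $\infty$. (i) There is a constant $c=c(p,q,\sigma,d)>0$ such that for every sequence $\{r_k\}_{k\ge1}$ of positive radii and every integer $L\ge1$ there are functions $f_k\in\mathcal E_o(r_k)\cap L^p(\mathbb R^d)$, $k=1,\dots,L$, not all zero, with $$\Big\|\Big(\sum_{k=1}^L|\mathfrak M_{\sigma,r_k}f_k|^q\Big)^{1/q}\Big\|_p\ \ge\ c\,\max\{L^{\frac1q-\frac\sigma d},\,(\log L)^{1/q}\}\ \Big\|\Big(\sum_{k=1}^L|f_k|^q\Big)^{1/q}\Big\|_p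 .$$ (ii) Consequently $\sigma>d/q$ is necessary for the vector-valued Peetre maximal inequality: for every sequence $\{r_k\}_{k\ge1}$ of positive radii there is no finite constant $C$ such that $$\Big\|\Big(\sum_{k}|\mathfrak M_{\sigma,r_k}f_k|^q\Big)^{1/q}\Big\|_p\le C\,\Big\|\Big(\sum_{k}|f_k|^q\Big)^{1/q}\Big\|_p$$ holds for all sequences $\{f_k\}_{k\ge1}$ with $f_k\in\mathcal E_o(r_k)\cap L^p(\mathbb R^d)$. -/

import Mathlib

open MeasureTheory SchwartzMap FourierTransform
open scoped ENNReal NNReal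

noncomputable section

/-- The support of the Fourier transform of a smooth function `f` on `ℝ^d` all of whose derivatives
grow at most polynomially, regarded as a tempered distribution. The Fourier transform is normalized
as `f̂(ξ) = ∫ f(x) e^{-i⟨x,ξ⟩} dx`, while Mathlib's `𝓕` uses the frequency variable `ξ / (2π)`. -/
def fourierSupport {d : ℕ} {f : EuclideanSpace ℝ (Fin d) → ℂ}
    (hf : Function.HasTemperateGrowth f) : Set (EuclideanSpace ℝ (Fin d)) :=
  {ξ | (2 * Real.pi)⁻¹ • ξ ∈ Distribution.dsupport
    (𝓕 (hf.toTemperedDistribution volume) : 𝓢'(EuclideanSpace ℝ (Fin d), ℂ))}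

/-- `𝓔(r)`: the smooth tempered distributions on `ℝ^d` whose Fourier transform is supported in
`{ξ : |ξ| ≤ r}`. By the Paley–Wiener–Schwartz theorem every tempered distribution with compactly
supported Fourier transform is (integration against) a unique smooth function all of whose
derivatives grow at most polynomially, so the elements are given as such functions. -/
def expType (d : ℕ) (r : ℝ) : Set (EuclideanSpace ℝ (Fin d) → ℂ) :=
  {f | ∃ hf : Function.HasTemperateGrowth f, fourierSupport hf ⊆ {ξ | ‖ξ‖ ≤ r}}

/-- `𝓔ₒ(r)`: the functions in `𝓔(r)` whose Fourier transform is supported in the annulus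
`{ξ : r / 2 ≤ |ξ| ≤ r}`. -/
def expTypeAnnulus (d : ℕ) (r : ℝ) : Set (EuclideanSpace ℝ (Fin d) → ℂ) :=
  {f | f ∈ expType d r ∧ ∃ hf : Function.HasTemperateGrowth f,
    fourierSupport hf ⊆ {ξ | r / 2 ≤ ‖ξ‖ ∧ ‖ξ‖ ≤ r}}

/-- The Peetre maximal function `𝔐_{σ,r} g (x) = sup_y |g (x + y)| / (1 + r |y|)^σ`, with values
in `[0, ∞]`. -/
def peetreMax {d : ℕ} (σ r : ℝ) (g : EuclideanSpace ℝ (Fin d) → ℂ)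
    (x : EuclideanSpace ℝ (Fin d)) : ℝ≥0∞ :=
  ⨆ y : EuclideanSpace ℝ (Fin d), ‖g (x + y)‖ₑ / ENNReal.ofReal ((1 + r * ‖y‖) ^ σ)

/-- The quantity `‖(∑_k F_k^q)^{1/q}‖_{L^p(ℝ^d)}`, in `[0, ∞]`, for a finite or infinite family
of `[0, ∞]`-valued functions and `0 < p, q < ∞`. -/
def mixedNorm {d : ℕ} {ι : Type} (p q : ℝ)
    (F : ι → EuclideanSpace ℝ (Fin d) → ℝ≥0∞) : ℝ≥0∞ :=
  eLpNorm (fun x => (∑' k, F k x ^ q) ^ (1 / q)) (ENNReal.ofReal p) volume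

end

/-! The extremal functions come from a random construction. Take `n ^ d` comparable to `L` and let
`f_k` be a product of three factors: a slowly varying envelope `ψ (ε • x)`, a plane wave placing the
spectrum inside the annulus of `r_k`, and a power of normalized Dirichlet kernels with peaks of
height 1 on a translate of a lattice of spacing `n / τ_k`, where `τ_k` is a fixed multiple of `r_k`.
The translates are indexed by residues `u ∈ (ZMod n)^d`, chosen independently and uniformly for each
`k`.

At a fixed `x`, the `q`-th powers of the peak functions sum to at most 1 over all residues
(`sum_norm_latticePeaks_rpow_le`). So `∑ |f_k|^q`, envelope aside, is a sum of at most `n ^ d`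
independent variables in `[0, 1]` of mean at most `n ^ (-d)`. Its exponential moment, hence its
moment of order `p / q`, is bounded uniformly in `L` (`sum_rpow_sum_le`).

The maximal function instead sees the nearby peaks: if `v` is the offset from the cell of `x` to a
peak, it is at least a constant times `(1 + coordMax v) ^ (-σ)`. As `u` varies, `v` runs through all
residues, and the sum of `(1 + coordMax v) ^ (-σ q)` is at least `n ^ (d - σ q)` and at least `log
n` when `σ q ≤ d`. Jensen's inequality with exponent `p / q ≥ 1` turns this mean into a lower bound
for the average `p`-th power of the norm.

Comparing the two averages yields one choice of translates that works. The width of the envelope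
depends on `L` and on the radii, but contributes the same factor `ε ^ (-d)` to both sides. No
relation between the radii is needed, since the randomness lies in the translates alone. -/

/-! ### Schwartz functions with prescribed spectrum -/

section FrequencySupport

variable {d : ℕ}

/-- `f` is a Schwartz function whose Fourier transform vanishes off `S`. -/
def SchwartzSpectrumIn (S : Set (EuclideanSpace ℝ (Fin d)))
    (f : EuclideanSpace ℝ (Fin d) → ℂ) : Prop :=
  ∃ F : 𝓢(EuclideanSpace ℝ (Fin d), ℂ), ⇑F = f ∧ ∀ ξ, 𝓕 F ξ ≠ 0 → ξ ∈ S

namespace SchwartzSpectrumIn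

variable {S T : Set (EuclideanSpace ℝ (Fin d))} {f g : EuclideanSpace ℝ (Fin d) → ℂ}

lemma zero : SchwartzSpectrumIn S (0 : EuclideanSpace ℝ (Fin d) → ℂ) :=
  ⟨0, by ext; simp, fun ξ h => absurd (by rw [FourierTransform.fourier_zero]; rfl) h⟩

lemma add (hf : SchwartzSpectrumIn S f) (hg : SchwartzSpectrumIn S g) :
    SchwartzSpectrumIn S (f + g) := by
  obtain ⟨F, rfl, hF⟩ := hf
  obtain ⟨G, rfl, hG⟩ := hg
  refine ⟨F + G, rfl, fun ξ h => ?_⟩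
  by_contra hξ
  have h1 : 𝓕 F ξ = 0 := by by_contra h'; exact hξ (hF ξ h')
  have h2 : 𝓕 G ξ = 0 := by by_contra h'; exact hξ (hG ξ h')
  apply h
  rw [FourierTransform.fourier_add, _root_.add_apply, h1, h2, add_zero]

lemma smul (c : ℂ) (hf : SchwartzSpectrumIn S f) : SchwartzSpectrumIn S (c • f) := by
  obtain ⟨F, rfl, hF⟩ := hf
  refine ⟨c • F, rfl, fun ξ h => hF ξ fun h1 => h ?_⟩
  rw [FourierTransform.fourier_smul, _root_.smul_apply, h1, smul_zero]

lemma mono (h : S ⊆ T) (hf : SchwartzSpectrumIn S f) : SchwartzSpectrumIn T f := by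
  obtain ⟨F, rfl, hF⟩ := hf
  exact ⟨F, rfl, fun ξ hξ => h (hF ξ hξ)⟩

lemma continuous (hf : SchwartzSpectrumIn S f) : Continuous f := by
  obtain ⟨F, rfl, -⟩ := hf
  exact F.continuous

lemma memLp (hf : SchwartzSpectrumIn S f) (p : ℝ≥0∞) : MemLp f p volume := by
  obtain ⟨F, rfl, -⟩ := hf
  exact F.memLp p volume

/-- Modulating and dilating a Schwartz function translates and dilates its spectrum. -/
lemma comp_smul_mul_exp {ψ : EuclideanSpace ℝ (Fin d) → ℂ}
    (hψ : SchwartzSpectrumIn (Metric.closedBall 0 1) ψ) {ε : ℝ} (hε : 0 < ε)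
    (a : EuclideanSpace ℝ (Fin d)) :
    SchwartzSpectrumIn (Metric.closedBall a ε)
      (fun x => ψ (ε • x) * Complex.exp (2 * Real.pi * Complex.I * (inner ℝ a x : ℝ))) := by
  obtain ⟨Ψ, rfl, hΨ⟩ := hψ
  set h : 𝓢(EuclideanSpace ℝ (Fin d), ℂ) := 𝓕 Ψ with hh
  let e : EuclideanSpace ℝ (Fin d) ≃L[ℝ] EuclideanSpace ℝ (Fin d) :=
    ContinuousLinearEquiv.smulLeft (Units.mk0 ε⁻¹ (inv_ne_zero hε.ne'))
  let H : 𝓢(EuclideanSpace ℝ (Fin d), ℂ) :=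
    ((h.compCLMOfContinuousLinearEquiv ℂ e).compSubConstCLM ℂ a)
  have hH : ∀ ξ, H ξ = h (ε⁻¹ • (ξ - a)) := fun ξ => rfl
  refine ⟨((ε ^ d)⁻¹ : ℂ) • 𝓕⁻ H, ?_, fun ξ hξ => ?_⟩
  · ext x
    have hΨx : Ψ (ε • x) = ∫ v, Real.fourierChar (inner ℝ v (ε • x)) • h v := by
      rw [← Real.fourierInv_eq, ← SchwartzMap.fourierInv_coe, hh,
        FourierTransform.fourierInv_fourier_eq]
    -- `Q` is the inversion integrand in the variable `w = ε⁻¹ • (v - a)`, so that invariance under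
    -- translation and scaling of Lebesgue measure finish the computation.
    obtain ⟨Q, hQ⟩ : ∃ Q : EuclideanSpace ℝ (Fin d) → ℂ, ∀ w, Q w =
        Complex.exp (2 * Real.pi * Complex.I * (inner ℝ a x : ℝ)) *
          (Real.fourierChar (inner ℝ w (ε • x)) • h w) := ⟨_, fun w => rfl⟩
    have hshift : ∀ v, Real.fourierChar (inner ℝ v x) • H v = Q (ε⁻¹ • (v - a)) := by
      intro v
      have : inner ℝ v x = inner ℝ a x + inner ℝ (ε⁻¹ • (v - a)) (ε • x) := by
        rw [inner_smul_left, inner_smul_right, inner_sub_left]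
        simp only [conj_trivial]
        field_simp
        ring
      simp only [hQ, hH, Circle.smul_def, Real.fourierChar_apply, smul_eq_mul]
      rw [← mul_assoc, ← Complex.exp_add, this]
      congr 2
      push_cast
      ring
    rw [_root_.smul_apply, SchwartzMap.fourierInv_coe, Real.fourierInv_eq]
    simp_rw [hshift]
    rw [integral_sub_right_eq_self (fun v : EuclideanSpace ℝ (Fin d) => Q (ε⁻¹ • v)),
      Measure.integral_comp_inv_smul_of_nonneg volume Q hε.le]
    simp_rw [hQ]
    rw [integral_const_mul, ← hΨx,
      finrank_euclideanSpace_fin, smul_eq_mul, Complex.real_smul]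
    have : (ε : ℂ) ≠ 0 := by exact_mod_cast hε.ne'
    push_cast
    field_simp
  · rw [FourierTransform.fourier_smul, FourierTransform.fourier_fourierInv_eq,
      _root_.smul_apply, hH] at hξ
    have := hΨ _ (right_ne_zero_of_mul hξ)
    rw [mem_closedBall_zero_iff, norm_smul, Real.norm_of_nonneg (by positivity),
      inv_mul_le_iff₀ hε, mul_one] at this
    rwa [mem_closedBall_iff_norm]

/-- A Schwartz function with spectrum in an annulus belongs to `expTypeAnnulus`. -/
lemma mem_expTypeAnnulus {r : ℝ}
    (hf : SchwartzSpectrumIn {ξ | r / (4 * Real.pi) ≤ ‖ξ‖ ∧ ‖ξ‖ ≤ r / (2 * Real.pi)} f) :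
    f ∈ expTypeAnnulus d r := by
  obtain ⟨F, rfl, hF⟩ := hf
  have key : fourierSupport F.hasTemperateGrowth ⊆ {ξ | r / 2 ≤ ‖ξ‖ ∧ ‖ξ‖ ≤ r} := by
    intro ξ hξ
    rw [fourierSupport, Set.mem_ofPred_eq, Distribution.mem_dsupport_iff] at hξ
    have := hξ {ξ | r / (4 * Real.pi) ≤ ‖ξ‖ ∧ ‖ξ‖ ≤ r / (2 * Real.pi)} ?_ ?_
    · rw [Set.mem_ofPred_eq, norm_smul, Real.norm_of_nonneg (by positivity)] at this
      have hpi := Real.pi_pos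
      constructor
      · have h1 := this.1
        rw [div_le_iff₀ (by positivity)] at h1
        field_simp at h1
        linarith
      · have h1 := this.2
        rw [le_div_iff₀ (by positivity)] at h1
        field_simp at h1
        linarith
    · intro u hu
      have : (𝓕 (F.hasTemperateGrowth.toTemperedDistribution volume) :
          𝓢'(EuclideanSpace ℝ (Fin d), ℂ)) u = ∫ x, u x • 𝓕 F x := by
        rw [TemperedDistribution.fourier_apply]
        exact SchwartzMap.integral_fourier_smul_eq u F
      rw [this]
      refine integral_eq_zero_of_ae (Filter.Eventually.of_forall fun x => ?_)
      by_cases hx : 𝓕 F x = 0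
      · simp [hx]
      · have : x ∉ tsupport u := fun h' => hu h' (hF x hx)
        simp [image_eq_zero_of_notMem_tsupport this]
    · exact (isClosed_le continuous_const continuous_norm).inter
        (isClosed_le continuous_norm continuous_const)
  exact ⟨⟨F.hasTemperateGrowth, fun ξ hξ => (key hξ).2⟩, F.hasTemperateGrowth, key⟩

end SchwartzSpectrumIn

/-- There is a Schwartz function with spectrum in the unit ball that is bounded below near `0`. -/
lemma exists_schwartz_spectrum_unitBall (d : ℕ) :
    ∃ ψ : EuclideanSpace ℝ (Fin d) → ℂ, SchwartzSpectrumIn (Metric.closedBall 0 1) ψ ∧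
      ∃ c > (0 : ℝ), ∃ δ > (0 : ℝ), ∀ x, ‖x‖ ≤ δ → c ≤ ‖ψ x‖ := by
  let b : ContDiffBump (0 : EuclideanSpace ℝ (Fin d)) := ⟨1/2, 1, by norm_num, by norm_num⟩
  have hbc : HasCompactSupport (fun x => (b x : ℂ)) :=
    b.hasCompactSupport.comp_left (g := fun t : ℝ => (t : ℂ)) (by simp)
  let B : 𝓢(EuclideanSpace ℝ (Fin d), ℂ) :=
    hbc.toSchwartzMap (Complex.ofRealCLM.contDiff.comp b.contDiff)
  have hB : ∀ x, B x = (b x : ℂ) := fun x => rfl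
  obtain ⟨G, hG⟩ : ∃ G : 𝓢(EuclideanSpace ℝ (Fin d), ℂ), G = 𝓕⁻ B := ⟨_, rfl⟩
  have h0 : G 0 ≠ 0 := by
    rw [hG, SchwartzMap.fourierInv_coe, Real.fourierInv_eq]
    simp only [inner_zero_right, AddChar.map_zero_eq_one, one_smul, hB]
    rw [integral_complex_ofReal]
    exact_mod_cast b.integral_pos.ne'
  refine ⟨⇑G, ⟨G, rfl, fun ξ hξ => ?_⟩, ‖G 0‖ / 2, by positivity, ?_⟩
  · rw [hG, FourierTransform.fourier_fourierInv_eq, hB] at hξ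
    have : ξ ∈ Function.support b := by simpa using hξ
    rw [b.support_eq] at this
    exact Metric.ball_subset_closedBall this
  · have hc : ContinuousAt (fun x => ‖G x‖) 0 := G.continuous.norm.continuousAt
    have := hc.eventually (lt_mem_nhds (half_lt_self (norm_pos_iff.2 h0)))
    obtain ⟨δ, hδ, H⟩ := Metric.eventually_nhds_iff.1 this
    refine ⟨δ / 2, by positivity, fun x hx => (H ?_).le⟩
    rw [dist_zero_right]
    linarith

end FrequencySupport

/-! ### Trigonometric polynomials and the Dirichlet kernel -/

section TrigonometricPolynomials

variable {d : ℕ}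

/-- The character `x ↦ e^{2πi⟨a,x⟩}`. -/
noncomputable def planeWave (a : EuclideanSpace ℝ (Fin d)) : EuclideanSpace ℝ (Fin d) → ℂ :=
  fun x => Complex.exp (2 * Real.pi * Complex.I * (inner ℝ a x : ℝ))

lemma planeWave_zero : planeWave (0 : EuclideanSpace ℝ (Fin d)) = 1 := by
  ext x; simp [planeWave]

lemma planeWave_add (a b : EuclideanSpace ℝ (Fin d)) :
    planeWave (a + b) = planeWave a * planeWave b := by
  ext x
  simp only [planeWave, Pi.mul_apply, ← Complex.exp_add, inner_add_left]
  congr 1; push_cast; ring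

lemma norm_planeWave (a x : EuclideanSpace ℝ (Fin d)) : ‖planeWave a x‖ = 1 := by
  rw [planeWave, show (2 * Real.pi * Complex.I * (inner ℝ a x : ℝ) : ℂ) =
    ((2 * Real.pi * inner ℝ a x : ℝ) : ℂ) * Complex.I by push_cast; ring,
    Complex.norm_exp_ofReal_mul_I]

/-- Trigonometric polynomials with frequencies in `S`. -/
noncomputable def trigPoly (S : Set (EuclideanSpace ℝ (Fin d))) :
    Submodule ℂ (EuclideanSpace ℝ (Fin d) → ℂ) :=
  Submodule.span ℂ (planeWave '' S)

lemma planeWave_mem_trigPoly {S : Set (EuclideanSpace ℝ (Fin d))} {a : EuclideanSpace ℝ (Fin d)}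
    (ha : a ∈ S) : planeWave a ∈ trigPoly S :=
  Submodule.subset_span ⟨a, ha, rfl⟩

lemma mul_mem_trigPoly {S T U : Set (EuclideanSpace ℝ (Fin d))}
    {f g : EuclideanSpace ℝ (Fin d) → ℂ} (hf : f ∈ trigPoly S) (hg : g ∈ trigPoly T)
    (h : ∀ a ∈ S, ∀ b ∈ T, a + b ∈ U) : f * g ∈ trigPoly U := by
  have := Submodule.mul_mem_mul hf hg
  rw [trigPoly, trigPoly, Submodule.span_mul_span] at this
  refine Submodule.span_mono ?_ this
  rintro _ ⟨_, ⟨a, ha, rfl⟩, _, ⟨b, hb, rfl⟩, rfl⟩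
  exact ⟨a + b, h a ha b hb, planeWave_add a b⟩

lemma prod_mem_trigPoly {ι : Type*} (s : Finset ι) {ρ : ℝ}
    {f : ι → EuclideanSpace ℝ (Fin d) → ℂ}
    (hf : ∀ i ∈ s, f i ∈ trigPoly (Metric.closedBall 0 ρ)) :
    ∏ i ∈ s, f i ∈ trigPoly (Metric.closedBall 0 (s.card * ρ)) := by
  classical
  induction s using Finset.induction_on with
  | empty =>
    rw [Finset.prod_empty, ← planeWave_zero]
    exact planeWave_mem_trigPoly (by simp)
  | insert i s hi ih =>
    rw [Finset.prod_insert hi, Finset.card_insert_of_notMem hi]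
    refine mul_mem_trigPoly (hf i (Finset.mem_insert_self i s))
      (ih fun j hj => hf j (Finset.mem_insert_of_mem hj)) fun a ha b hb => ?_
    rw [mem_closedBall_zero_iff] at *
    push_cast
    linarith [norm_add_le a b]

lemma SchwartzSpectrumIn.comp_smul_mul_trigPoly {ψ : EuclideanSpace ℝ (Fin d) → ℂ}
    (hψ : SchwartzSpectrumIn (Metric.closedBall 0 1) ψ) {ε : ℝ} (hε : 0 < ε)
    {S T : Set (EuclideanSpace ℝ (Fin d))} (hST : ∀ a ∈ S, Metric.closedBall a ε ⊆ T)
    {g : EuclideanSpace ℝ (Fin d) → ℂ} (hg : g ∈ trigPoly S) :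
    SchwartzSpectrumIn T (fun x => ψ (ε • x) * g x) := by
  induction hg using Submodule.span_induction with
  | mem g hg =>
    obtain ⟨a, ha, rfl⟩ := hg
    exact (hψ.comp_smul_mul_exp hε a).mono (hST a ha)
  | zero => simpa using! SchwartzSpectrumIn.zero (S := T)
  | add f g _ _ hf hg =>
    convert hf.add hg using 1
    ext x; simp [mul_add]
  | smul c g _ hg =>
    convert hg.smul c using 1
    ext x; simp; ring

/-- The normalized Dirichlet kernel with `n` frequencies and period `n`. -/
noncomputable def dirichletMean (n : ℕ) (t : ℝ) : ℂ :=
  (n : ℂ)⁻¹ * ∑ m ∈ Finset.range n, Complex.exp (2 * Real.pi * Complex.I * m * t / n)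

lemma norm_dirichletMean_le_one (n : ℕ) (t : ℝ) : ‖dirichletMean n t‖ ≤ 1 := by
  rw [dirichletMean, norm_mul, norm_inv, Complex.norm_natCast]
  have : ‖∑ m ∈ Finset.range n, Complex.exp (2 * Real.pi * Complex.I * m * t / n)‖ ≤ n := by
    refine (norm_sum_le _ _).trans ?_
    refine (Finset.sum_le_card_nsmul _ _ 1 fun m _ => ?_).trans (by simp)
    rw [show (2 * Real.pi * Complex.I * m * t / n : ℂ) =
      ((2 * Real.pi * m * t / n : ℝ) : ℂ) * Complex.I by push_cast; ring,
      Complex.norm_exp_ofReal_mul_I]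
  rcases Nat.eq_zero_or_pos n with rfl | hn
  · simp
  · rw [inv_mul_le_iff₀ (by positivity), mul_one]
    exact this

lemma dirichletMean_intCast_of_dvd {n : ℕ} [NeZero n] {j : ℤ} (h : (n : ℤ) ∣ j) :
    dirichletMean n j = 1 := by
  obtain ⟨k, rfl⟩ := h
  have hn : (n : ℂ) ≠ 0 := by exact_mod_cast NeZero.ne n
  rw [dirichletMean, Finset.sum_congr rfl (g := fun _ => (1 : ℂ)) fun m _ => ?_]
  · simp [hn]
  · rw [Complex.exp_eq_one_iff]
    refine ⟨m * k, ?_⟩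
    push_cast
    field_simp

/-- Parseval on `ZMod n`: after expanding the square, orthogonality of characters leaves only the
`n` diagonal terms, each contributing `n` before normalization by `n⁻²`. -/
lemma sum_sq_norm_dirichletMean_sub (n : ℕ) [NeZero n] (t : ℝ) :
    ∑ u : ZMod n, ‖dirichletMean n (t - u.val)‖ ^ 2 = 1 := by
  have hn : (n : ℂ) ≠ 0 := by exact_mod_cast NeZero.ne n
  have key : ∀ u : ZMod n, ((‖dirichletMean n (t - u.val)‖ ^ 2 : ℝ) : ℂ) =
      ((n : ℂ)⁻¹) ^ 2 * ∑ m ∈ Finset.range n, ∑ m' ∈ Finset.range n,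
        Complex.exp (2 * Real.pi * Complex.I * ((m : ℂ) - m') * t / n) *
          ZMod.stdAddChar (u * (((m' : ℤ) - (m : ℤ) : ℤ) : ZMod n)) := by
    intro u
    rw [Complex.ofReal_pow, ← Complex.mul_conj', dirichletMean, map_mul, map_sum,
      mul_mul_mul_comm, Finset.sum_mul_sum]
    congr 1
    · simp [sq]
    · refine Finset.sum_congr rfl fun m _ => Finset.sum_congr rfl fun m' _ => ?_
      have hu : (u * (((m' : ℤ) - (m : ℤ) : ℤ) : ZMod n)) =
          (((u.val : ℤ) * ((m' : ℤ) - (m : ℤ)) : ℤ) : ZMod n) := by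
        push_cast
        rw [ZMod.natCast_zmod_val]
      rw [hu, ZMod.stdAddChar_coe, ← Complex.exp_conj, ← Complex.exp_add, ← Complex.exp_add]
      congr 1
      simp only [map_div₀, map_mul, Complex.conj_I, Complex.conj_ofReal, map_natCast, map_ofNat]
      push_cast
      field_simp
      ring
  have hsum : ((∑ u : ZMod n, ‖dirichletMean n (t - u.val)‖ ^ 2 : ℝ) : ℂ) = 1 := by
    rw [Complex.ofReal_sum, Finset.sum_congr rfl fun u _ => key u, ← Finset.mul_sum,
      Finset.sum_comm]
    have inner_sum : ∀ m ∈ Finset.range n, ∑ u : ZMod n, ∑ m' ∈ Finset.range n,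
        Complex.exp (2 * Real.pi * Complex.I * ((m : ℂ) - m') * t / n) *
          ZMod.stdAddChar (u * (((m' : ℤ) - (m : ℤ) : ℤ) : ZMod n)) = n := by
      intro m hm
      rw [Finset.sum_comm, Finset.sum_eq_single m]
      · simp
      · intro m' hm' hne
        rw [← Finset.mul_sum, AddChar.sum_mulShift _ (ZMod.isPrimitive_stdAddChar n), if_neg,
          Nat.cast_zero, mul_zero]
        intro h0
        apply hne
        rw [Finset.mem_range] at hm hm'
        push_cast at h0
        rw [sub_eq_zero, ZMod.natCast_eq_natCast_iff, Nat.ModEq, Nat.mod_eq_of_lt hm,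
          Nat.mod_eq_of_lt hm'] at h0
        exact h0
      · exact fun h => absurd hm h
    rw [Finset.sum_congr rfl inner_sum]
    simp
    field_simp
  exact_mod_cast hsum

lemma dirichletMean_mem_trigPoly (n : ℕ) (τ b : ℝ) (i : Fin d) :
    (fun x : EuclideanSpace ℝ (Fin d) => dirichletMean n (τ * x i - b)) ∈
      trigPoly (Metric.closedBall 0 |τ|) := by
  have : (fun x : EuclideanSpace ℝ (Fin d) => dirichletMean n (τ * x i - b)) =
      ∑ m ∈ Finset.range n,
        ((n : ℂ)⁻¹ * Complex.exp (-(2 * Real.pi * Complex.I * m * b / n))) •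
          planeWave ((m / n * τ) • EuclideanSpace.single i (1 : ℝ)) := by
    ext x
    simp only [dirichletMean, Finset.mul_sum, Finset.sum_apply, Pi.smul_apply, smul_eq_mul,
      planeWave, inner_smul_left, EuclideanSpace.inner_single_left]
    refine Finset.sum_congr rfl fun m _ => ?_
    rw [mul_assoc ((n : ℂ)⁻¹), ← Complex.exp_add]
    congr 2
    simp only [map_one, conj_trivial]
    push_cast
    ring
  rw [this]
  refine Submodule.sum_mem _ fun m hm => Submodule.smul_mem _ _ (planeWave_mem_trigPoly ?_)
  rw [mem_closedBall_zero_iff, norm_smul, PiLp.norm_single, norm_one, mul_one,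
    Real.norm_eq_abs, abs_mul]
  refine mul_le_of_le_one_left (abs_nonneg _) ?_
  rw [abs_of_nonneg (by positivity)]
  exact div_le_one_of_le₀ (by exact_mod_cast (Finset.mem_range.1 hm).le) (by positivity)

end TrigonometricPolynomials

/-! ### Moments of independent sums and lattice sums -/

section Averages

/-- Exponential moments of a sum of independent variables with values in `[0, 1]` and small mean. -/
lemma sum_exp_sum_le {L : ℕ} {Ω : Type*} [Fintype Ω] (X : Fin L → Ω → ℝ)
    (h0 : ∀ k u, 0 ≤ X k u) (h1 : ∀ k u, X k u ≤ 1) (hsum : ∀ k, ∑ u, X k u ≤ 1)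
    (hL : L ≤ Fintype.card Ω) :
    ∑ ω : Fin L → Ω, Real.exp (∑ k, X k (ω k)) ≤
      Real.exp 2 * Fintype.card (Fin L → Ω) := by
  classical
  rcases Nat.eq_zero_or_pos L with rfl | hLpos
  · simp
  set N := Fintype.card Ω with hN
  have hNpos : (0 : ℝ) < N := by exact_mod_cast hLpos.trans_le hL
  have hexp : ∀ k u, Real.exp (X k u) ≤ 1 + 2 * X k u := by
    intro k u
    have := Real.abs_exp_sub_one_le (x := X k u) (by rw [abs_of_nonneg (h0 k u)]; exact h1 k u)
    rw [abs_of_nonneg (h0 k u)] at this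
    linarith [le_abs_self (Real.exp (X k u) - 1)]
  calc ∑ ω : Fin L → Ω, Real.exp (∑ k, X k (ω k))
      = ∏ k, ∑ u, Real.exp (X k u) := by
        simp_rw [Real.exp_sum]
        rw [Finset.prod_univ_sum, Fintype.piFinset_univ]
    -- Independence has factored the sum; each factor is bounded through `exp x ≤ 1 + 2 x` on `[0,
    -- 1]` and the total mass 1 of `X k`.
    _ ≤ ∏ _k : Fin L, ((N : ℝ) + 2) := by
        refine Finset.prod_le_prod (fun k _ => Finset.sum_nonneg fun u _ => (Real.exp_pos _).le)
          fun k _ => (Finset.sum_le_sum fun u _ => hexp k u).trans ?_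
        rw [Finset.sum_add_distrib, ← Finset.mul_sum]
        simp only [Finset.sum_const, Finset.card_univ, nsmul_eq_mul, mul_one]
        linarith [hsum k]
    _ = ((N : ℝ) * (1 + 2 / N)) ^ L := by
        rw [Finset.prod_const, Finset.card_univ, Fintype.card_fin]
        congr 1; field_simp
    _ ≤ ((N : ℝ) * Real.exp (2 / N)) ^ L := by
        gcongr
        linarith [Real.add_one_le_exp (2 / (N : ℝ))]
    _ = Real.exp (L * (2 / N)) * (N : ℝ) ^ L := by
        rw [mul_pow, ← Real.exp_nat_mul, mul_comm]
    _ ≤ Real.exp 2 * (N : ℝ) ^ L := by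
        gcongr
        rw [mul_div_assoc', div_le_iff₀ hNpos]
        have : (L : ℝ) ≤ N := by exact_mod_cast hL
        linarith
    _ = _ := by simp [hN]

lemma rpow_le_factorial_mul_exp {t a : ℝ} (ht : 0 ≤ t) (ha : 0 ≤ a) :
    t ^ a ≤ (1 + (Nat.factorial ⌈a⌉₊ : ℝ)) * Real.exp t := by
  have hexp : 1 ≤ Real.exp t := Real.one_le_exp ht
  have hpow : t ^ ⌈a⌉₊ ≤ Nat.factorial ⌈a⌉₊ * Real.exp t := by
    have := Real.pow_div_factorial_le_exp t ht ⌈a⌉₊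
    rwa [div_le_iff₀ (by positivity), mul_comm] at this
  rcases le_total t 1 with h | h
  · have := Real.rpow_le_one ht h ha
    have : 0 ≤ (Nat.factorial ⌈a⌉₊ : ℝ) * Real.exp t := by positivity
    linarith
  · have : t ^ a ≤ t ^ (⌈a⌉₊ : ℝ) := Real.rpow_le_rpow_of_exponent_le h (Nat.le_ceil a)
    rw [Real.rpow_natCast] at this
    linarith

lemma sum_rpow_sum_le {L : ℕ} {Ω : Type*} [Fintype Ω] (X : Fin L → Ω → ℝ)
    (h0 : ∀ k u, 0 ≤ X k u) (h1 : ∀ k u, X k u ≤ 1) (hsum : ∀ k, ∑ u, X k u ≤ 1)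
    (hL : L ≤ Fintype.card Ω) {a : ℝ} (ha : 0 ≤ a) :
    ∑ ω : Fin L → Ω, (∑ k, X k (ω k)) ^ a ≤
      (1 + (Nat.factorial ⌈a⌉₊ : ℝ)) * Real.exp 2 * Fintype.card (Fin L → Ω) := by
  refine (Finset.sum_le_sum fun ω _ => rpow_le_factorial_mul_exp
    (Finset.sum_nonneg fun k _ => h0 k (ω k)) ha).trans ?_
  rw [← Finset.mul_sum, mul_assoc]
  gcongr
  exact sum_exp_sum_le X h0 h1 hsum hL

/-- The sum over independent coordinates of functions of one coordinate. -/
lemma sum_pi_sum_eval {L : ℕ} {Ω : Type*} [Fintype Ω] (Y : Fin L → Ω → ℝ) :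
    (Fintype.card Ω : ℝ) * ∑ ω : Fin L → Ω, ∑ k, Y k (ω k) =
      Fintype.card (Fin L → Ω) * ∑ k, ∑ u, Y k u := by
  classical
  rw [Finset.sum_comm, Finset.mul_sum, Finset.mul_sum]
  refine Finset.sum_congr rfl fun k _ => ?_
  have := (Equiv.funSplitAt k Ω).sum_comp (fun z : Ω × ({j // j ≠ k} → Ω) => Y k z.1)
  have h2 : ∑ ω : Fin L → Ω, Y k (ω k) =
      (Fintype.card ({j // j ≠ k} → Ω) : ℝ) * ∑ u, Y k u := by
    rw [Fintype.sum_prod_type] at this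
    simp only [Finset.sum_const, Finset.card_univ, nsmul_eq_mul, ← Finset.mul_sum] at this
    rw [← this]
    rfl
  rw [h2, Fintype.card_congr (Equiv.funSplitAt k Ω), Fintype.card_prod]
  push_cast
  ring

/-- Jensen's inequality for a sum of independent variables. -/
lemma le_sum_rpow_sum {L : ℕ} {Ω : Type*} [Fintype Ω] [Nonempty Ω] (Y : Fin L → Ω → ℝ)
    (h0 : ∀ k u, 0 ≤ Y k u) {B : ℝ} (hB : 0 ≤ B)
    (h : B * Fintype.card Ω ≤ ∑ k, ∑ u, Y k u) {a : ℝ} (ha : 1 ≤ a) :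
    Fintype.card (Fin L → Ω) * B ^ a ≤ ∑ ω : Fin L → Ω, (∑ k, Y k (ω k)) ^ a := by
  have hN : (0 : ℝ) < Fintype.card Ω := by exact_mod_cast Fintype.card_pos
  have hW : (0 : ℝ) < Fintype.card (Fin L → Ω) := by exact_mod_cast Fintype.card_pos
  have hmean : Fintype.card (Fin L → Ω) * B ≤ ∑ ω : Fin L → Ω, ∑ k, Y k (ω k) := by
    refine le_of_mul_le_mul_left ?_ hN
    rw [sum_pi_sum_eval Y]
    calc _ = (Fintype.card (Fin L → Ω) : ℝ) * (B * Fintype.card Ω) := by ring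
      _ ≤ _ := by gcongr
  have hJ := Real.rpow_sum_le_const_mul_sum_rpow_of_nonneg (s := Finset.univ)
    (f := fun ω : Fin L → Ω => ∑ k, Y k (ω k)) ha
    fun ω _ => Finset.sum_nonneg fun k _ => h0 k (ω k)
  have h1 := (Real.rpow_le_rpow (by positivity) hmean (by linarith : (0 : ℝ) ≤ a)).trans hJ
  rw [Finset.card_univ, Real.mul_rpow hW.le hB] at h1
  refine le_of_mul_le_mul_left (le_trans (le_of_eq ?_) h1) (Real.rpow_pos_of_pos hW (a - 1))
  rw [← mul_assoc]
  congr 1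
  conv_rhs => rw [show a = (a - 1) + 1 by ring, Real.rpow_add_one hW.ne']

lemma sum_zmod_val {n : ℕ} [NeZero n] {M : Type*} [AddCommMonoid M] (F : ℕ → M) :
    ∑ a : ZMod n, F a.val = ∑ m ∈ Finset.range n, F m := by
  obtain ⟨k, rfl⟩ := Nat.exists_eq_succ_of_ne_zero (NeZero.ne n)
  exact Fin.sum_univ_eq_sum_range F (k + 1)

/-- The largest coordinate of a vector of residues. -/
def coordMax {d n : ℕ} (v : Fin d → ZMod n) : ℕ := Finset.univ.sup fun i => (v i).val

lemma val_le_coordMax {d n : ℕ} (v : Fin d → ZMod n) (i : Fin d) : (v i).val ≤ coordMax v :=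
  Finset.le_sup (f := fun i => (v i).val) (Finset.mem_univ i)

/-- Each of the `n ^ d` terms is at least `n ^ (-β)`, because `1 + coordMax v ≤ n`. -/
lemma rpow_le_sum_coordMax (d n : ℕ) [NeZero n] {β : ℝ} (hβ : 0 ≤ β) :
    (n : ℝ) ^ ((d : ℝ) - β) ≤ ∑ v : Fin d → ZMod n, (1 + (coordMax v : ℝ)) ^ (-β) := by
  have hn : (0 : ℝ) < n := by exact_mod_cast Nat.pos_of_ne_zero (NeZero.ne n)
  have hle : ∀ v : Fin d → ZMod n, (n : ℝ) ^ (-β) ≤ (1 + (coordMax v : ℝ)) ^ (-β) := by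
    intro v
    refine Real.rpow_le_rpow_of_nonpos (by positivity) ?_ (by linarith)
    have : coordMax v < n := (Finset.sup_lt_iff (Nat.pos_of_ne_zero (NeZero.ne n))).2
      fun i _ => ZMod.val_lt (v i)
    exact_mod_cast (by omega : 1 + coordMax v ≤ n)
  refine le_trans (le_of_eq ?_) (Finset.sum_le_sum fun v _ => hle v)
  simp only [Finset.sum_const, Finset.card_univ, nsmul_eq_mul, Fintype.card_pi, ZMod.card,
    Finset.prod_const, Fintype.card_fin]
  rw [sub_eq_add_neg, Real.rpow_add hn, Nat.cast_pow, Real.rpow_natCast]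

/-- The vectors whose first coordinate `a` is the largest already give a harmonic sum: there are `(a
+ 1) ^ (d - 1)` of them, each contributing at least `(1 + a) ^ (-d)`. -/
lemma log_le_sum_coordMax {d : ℕ} (hd : 0 < d) (n : ℕ) [NeZero n] {β : ℝ}
    (hβd : β ≤ d) :
    Real.log n ≤ ∑ v : Fin d → ZMod n, (1 + (coordMax v : ℝ)) ^ (-β) := by
  obtain ⟨e, rfl⟩ := Nat.exists_eq_succ_of_ne_zero hd.ne'
  have hn : 0 < n := Nat.pos_of_ne_zero (NeZero.ne n)
  calc Real.log n ≤ Real.log ((n + 1 : ℕ) : ℝ) :=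
        Real.log_le_log (by exact_mod_cast hn) (by push_cast; linarith)
    _ ≤ (harmonic n : ℝ) := log_add_one_le_harmonic n
    _ = ∑ a : ZMod n, ((1 : ℝ) + a.val)⁻¹ := by
        rw [sum_zmod_val (fun m => ((1 : ℝ) + m)⁻¹), harmonic]
        push_cast
        exact Finset.sum_congr rfl fun m _ => by rw [add_comm]
    _ ≤ ∑ a : ZMod n, ∑ w : Fin e → ZMod n,
          (1 + (coordMax (Fin.cons a w : Fin (e + 1) → ZMod n) : ℝ)) ^ (-β) := by
        refine Finset.sum_le_sum fun a _ => ?_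
        let A : Finset (Fin e → ZMod n) :=
          Fintype.piFinset fun _ => Finset.univ.filter fun z : ZMod n => z.val ≤ a.val
        have hcard : (a.val + 1) ^ e ≤ A.card := by
          have h1 : a.val + 1 ≤ (Finset.univ.filter fun z : ZMod n => z.val ≤ a.val).card := by
            have h2 : (Finset.range (a.val + 1)).card ≤
                (Finset.univ.filter fun z : ZMod n => z.val ≤ a.val).card := by
              refine Finset.card_le_card_of_injOn (fun m : ℕ => (m : ZMod n)) ?_ ?_
              · intro m hm
                have hm' : m ≤ a.val := Nat.lt_succ_iff.1 (Finset.mem_range.1 hm)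
                simp only [Finset.coe_filter, Finset.mem_univ, true_and, Set.mem_ofPred_eq]
                rwa [ZMod.val_natCast_of_lt (hm'.trans_lt (ZMod.val_lt a))]
              · intro m hm m' hm' h
                have hlt : ∀ k ∈ (Finset.range (a.val + 1) : Set ℕ), k < n := fun k hk =>
                  (Nat.lt_succ_iff.1 (Finset.mem_range.1 hk)).trans_lt (ZMod.val_lt a)
                have := congrArg ZMod.val h
                simp only at this
                rwa [ZMod.val_natCast_of_lt (hlt m hm), ZMod.val_natCast_of_lt (hlt m' hm')]
                  at this
            rwa [Finset.card_range] at h2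
          rw [Fintype.card_piFinset]
          simp only [Finset.prod_const, Finset.card_univ, Fintype.card_fin]
          exact Nat.pow_le_pow_left h1 e
        have hpos : (0 : ℝ) < 1 + (a.val : ℝ) := by positivity
        calc ((1 : ℝ) + a.val)⁻¹
            = ((a.val + 1) ^ e : ℕ) * ((1 : ℝ) + a.val) ^ (-((e + 1 : ℕ) : ℝ)) := by
              rw [Real.rpow_neg hpos.le, Real.rpow_natCast]
              push_cast
              rw [add_comm (a.val : ℝ) 1, pow_succ]
              field_simp
          _ ≤ (A.card : ℝ) * ((1 : ℝ) + a.val) ^ (-((e + 1 : ℕ) : ℝ)) := by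
              gcongr
          _ = ∑ _w ∈ A, ((1 : ℝ) + a.val) ^ (-((e + 1 : ℕ) : ℝ)) := by simp
          _ ≤ ∑ w ∈ A, (1 + (coordMax (Fin.cons a w : Fin (e + 1) → ZMod n) : ℝ)) ^ (-β) := by
              refine Finset.sum_le_sum fun w hw => ?_
              have hV : coordMax (Fin.cons a w : Fin (e + 1) → ZMod n) = a.val := by
                refine le_antisymm (Finset.sup_le fun i _ => ?_)
                  (by simpa using val_le_coordMax (Fin.cons a w : Fin (e + 1) → ZMod n) 0)
                refine Fin.cases ?_ (fun j => ?_) i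
                · simp
                · have := Fintype.mem_piFinset.1 hw j
                  simpa using this
              rw [hV]
              exact Real.rpow_le_rpow_of_exponent_le (by linarith [(Nat.cast_nonneg a.val : (0 : ℝ) ≤ a.val)])
                (by linarith)
          _ ≤ _ := Finset.sum_le_sum_of_subset_of_nonneg (Finset.subset_univ A)
              fun w _ _ => by positivity
    _ = _ := by
        rw [← Fintype.sum_prod_type']
        exact (Fin.consEquiv fun _ : Fin (e + 1) => ZMod n).sum_comp
          fun v => (1 + (coordMax v : ℝ)) ^ (-β)

end Averages

/-! ### Periodic arrays of peaks -/

section PeriodicPeaks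

variable {d : ℕ}

/-- A modulated trigonometric polynomial with peaks on the lattice `(u + n ℤ^d) / τ`. -/
noncomputable def latticePeaks {n : ℕ} (a : EuclideanSpace ℝ (Fin d)) (τ : ℝ) (s : ℕ)
    (u : Fin d → ZMod n) : EuclideanSpace ℝ (Fin d) → ℂ :=
  planeWave a * ∏ i, ∏ _j ∈ Finset.range s, fun x => dirichletMean n (τ * x i - (u i).val)

lemma latticePeaks_mem_trigPoly {n : ℕ} (a : EuclideanSpace ℝ (Fin d)) (τ : ℝ) (s : ℕ)
    (u : Fin d → ZMod n) :
    latticePeaks a τ s u ∈ trigPoly (Metric.closedBall a (d * (s * |τ|))) := by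
  have h := prod_mem_trigPoly (Finset.univ : Finset (Fin d)) fun i _ =>
    prod_mem_trigPoly (Finset.range s) fun _ _ => dirichletMean_mem_trigPoly n τ (u i).val i
  rw [Finset.card_range, Finset.card_univ, Fintype.card_fin] at h
  refine mul_mem_trigPoly (planeWave_mem_trigPoly (Set.mem_singleton a)) h fun b hb c hc => ?_
  rw [Set.mem_singleton_iff.1 hb, mem_closedBall_iff_norm, add_sub_cancel_left]
  exact mem_closedBall_zero_iff.1 hc

lemma norm_latticePeaks {n : ℕ} (a : EuclideanSpace ℝ (Fin d)) (τ : ℝ) (s : ℕ)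
    (u : Fin d → ZMod n) (x : EuclideanSpace ℝ (Fin d)) :
    ‖latticePeaks a τ s u x‖ = ∏ i, ‖dirichletMean n (τ * x i - (u i).val)‖ ^ s := by
  simp [latticePeaks, norm_planeWave, Finset.prod_apply, norm_prod]

lemma norm_latticePeaks_le_one {n : ℕ} (a : EuclideanSpace ℝ (Fin d)) (τ : ℝ) (s : ℕ)
    (u : Fin d → ZMod n) (x : EuclideanSpace ℝ (Fin d)) :
    ‖latticePeaks a τ s u x‖ ≤ 1 := by
  rw [norm_latticePeaks]
  exact Finset.prod_le_one (fun i _ => by positivity)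
    fun i _ => pow_le_one₀ (norm_nonneg _) (norm_dirichletMean_le_one _ _)

lemma sum_norm_latticePeaks_rpow_le (n : ℕ) [NeZero n] (a : EuclideanSpace ℝ (Fin d)) (τ : ℝ)
    {s : ℕ} {q : ℝ} (hsq : 2 ≤ s * q) (x : EuclideanSpace ℝ (Fin d)) :
    ∑ u : Fin d → ZMod n, ‖latticePeaks a τ s u x‖ ^ q ≤ 1 := by
  classical
  calc ∑ u : Fin d → ZMod n, ‖latticePeaks a τ s u x‖ ^ q
      ≤ ∑ u : Fin d → ZMod n, ∏ i, ‖dirichletMean n (τ * x i - (u i).val)‖ ^ 2 := by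
        refine Finset.sum_le_sum fun u _ => ?_
        rw [norm_latticePeaks, ← Real.finsetProd_rpow _ _ fun i _ => by positivity]
        refine Finset.prod_le_prod (fun i _ => by positivity) fun i _ => ?_
        -- The kernel is at most 1 in modulus, so raising the exponent from 2 to `s * q` only
        -- decreases it; the squares then sum to 1 exactly.
        rw [← Real.rpow_natCast _ s, ← Real.rpow_mul (norm_nonneg _), ← Real.rpow_natCast _ 2]
        exact Real.rpow_le_rpow_of_exponent_ge_of_imp (norm_nonneg _)
          (norm_dirichletMean_le_one _ _) (by simpa using hsq) fun _ h => by
            rcases mul_eq_zero.1 h with h | h <;> simp [h] at hsq <;> linarith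
    _ = ∏ i, ∑ b : ZMod n, ‖dirichletMean n (τ * x i - b.val)‖ ^ 2 := by
        rw [Finset.prod_univ_sum, Fintype.piFinset_univ]
    _ = 1 := Finset.prod_eq_one fun i _ => sum_sq_norm_dirichletMean_sub n _

/-- Every point has a peak of `latticePeaks` nearby. -/
lemma exists_norm_latticePeaks_eq_one {n : ℕ} [NeZero n] (a : EuclideanSpace ℝ (Fin d)) {τ : ℝ}
    (hτ : 0 < τ) (s : ℕ) (u : Fin d → ZMod n) (x : EuclideanSpace ℝ (Fin d)) :
    ∃ y : EuclideanSpace ℝ (Fin d), ‖latticePeaks a τ s u (x + y)‖ = 1 ∧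
      ‖y‖ ≤ d * (1 + coordMax fun i => u i - ((⌊τ * x i⌋ : ℤ) : ZMod n)) / τ := by
  set v : Fin d → ZMod n := fun i => u i - ((⌊τ * x i⌋ : ℤ) : ZMod n) with hv
  -- In each coordinate, round `τ * x i` down and move up by the residue `v i`; this lands on a
  -- point congruent to `u i` modulo `n`.
  let y : EuclideanSpace ℝ (Fin d) :=
    WithLp.toLp 2 fun i => (⌊τ * x i⌋ + ((v i).val : ℝ) - τ * x i) / τ
  have hy : ∀ i, y i = (⌊τ * x i⌋ + ((v i).val : ℝ) - τ * x i) / τ := fun i => rfl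
  refine ⟨y, ?_, ?_⟩
  · rw [norm_latticePeaks]
    refine Finset.prod_eq_one fun i _ => ?_
    have h1 : τ * (x + y) i - (u i).val = ((⌊τ * x i⌋ + (v i).val - (u i).val : ℤ) : ℝ) := by
      rw [PiLp.add_apply, hy]
      push_cast
      field_simp
      ring
    rw [h1, dirichletMean_intCast_of_dvd, norm_one, one_pow]
    rw [← ZMod.intCast_zmod_eq_zero_iff_dvd]
    push_cast
    rw [ZMod.natCast_zmod_val, ZMod.natCast_zmod_val, hv]
    ring
  · have hcoord : ∀ i, ‖y i‖ ≤ (1 + coordMax v) / τ := by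
      intro i
      rw [hy, norm_div, Real.norm_of_nonneg hτ.le]
      gcongr
      have h1 := Int.floor_le (τ * x i)
      have h2 := Int.lt_floor_add_one (τ * x i)
      have h3 : ((v i).val : ℝ) ≤ coordMax v := by exact_mod_cast val_le_coordMax v i
      have h4 : (0 : ℝ) ≤ (v i).val := Nat.cast_nonneg _
      rw [Real.norm_eq_abs, abs_le]
      constructor <;> linarith
    calc ‖y‖ = ‖∑ i, EuclideanSpace.single i (y i)‖ := by
          congr 1
          ext j
          simp [Finset.sum_apply]
      _ ≤ ∑ i, ‖y i‖ := (norm_sum_le _ _).trans (le_of_eq (by simp))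
      _ ≤ ∑ _i : Fin d, (1 + coordMax v) / τ := Finset.sum_le_sum fun i _ => hcoord i
      _ = _ := by simp; ring

end PeriodicPeaks

/-! ### Averaged bounds for the functions and their maximal functions -/

section PeetreMaximalFunction

variable {d : ℕ}

lemma mixedNorm_eq_lintegral {ι : Type} {p q : ℝ} (hp : 0 < p)
    (F : ι → EuclideanSpace ℝ (Fin d) → ℝ≥0∞) :
    mixedNorm p q F = (∫⁻ x, (∑' k, F k x ^ q) ^ (p / q)) ^ (1 / p) := by
  rw [mixedNorm, eLpNorm_eq_lintegral_rpow_enorm_toReal (by simpa using hp) ENNReal.ofReal_ne_top,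
    ENNReal.toReal_ofReal hp.le]
  simp only [enorm_eq_self, ← ENNReal.rpow_mul]
  congr 3
  ext x
  congr 1
  ring

lemma lintegral_comp_smul_of_pos {F : EuclideanSpace ℝ (Fin d) → ℝ≥0∞} (hF : Measurable F)
    {ε : ℝ} (hε : 0 < ε) :
    ∫⁻ x, F (ε • x) = ENNReal.ofReal ((ε ^ d)⁻¹) * ∫⁻ x, F x := by
  rw [← lintegral_map hF (measurable_const_smul ε), Measure.map_addHaar_smul volume hε.ne',
    lintegral_smul_measure, finrank_euclideanSpace_fin, abs_of_pos (by positivity), smul_eq_mul]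

lemma measurable_peetreMax {σ r : ℝ} (hr : 0 ≤ r) {g : EuclideanSpace ℝ (Fin d) → ℂ}
    (hg : Continuous g) : Measurable (peetreMax σ r g) := by
  have : LowerSemicontinuous (peetreMax σ r g) := by
    refine lowerSemicontinuous_iSup fun y => Continuous.lowerSemicontinuous ?_
    refine (ENNReal.continuous_div_const _ ?_).comp
      (hg.comp (continuous_id.add continuous_const)).enorm
    rw [Ne, ENNReal.ofReal_eq_zero, not_le]
    positivity
  exact this.measurable

lemma ofReal_le_peetreMax {σ r M c : ℝ} (hσ : 0 ≤ σ) (hr : 0 ≤ r)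
    {g : EuclideanSpace ℝ (Fin d) → ℂ} {x y : EuclideanSpace ℝ (Fin d)}
    (hc : c ≤ ‖g (x + y)‖) (hy : 1 + r * ‖y‖ ≤ M) :
    ENNReal.ofReal (c * M ^ (-σ)) ≤ peetreMax σ r g x := by
  refine le_trans ?_ (le_iSup (fun y => ‖g (x + y)‖ₑ / ENNReal.ofReal ((1 + r * ‖y‖) ^ σ)) y)
  have h1 : 0 < 1 + r * ‖y‖ := by positivity
  rw [← ofReal_norm, ← ENNReal.ofReal_div_of_pos (by positivity), div_eq_mul_inv,
    ← Real.rpow_neg h1.le]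
  refine ENNReal.ofReal_le_ofReal ?_
  have h2 : M ^ (-σ) ≤ (1 + r * ‖y‖) ^ (-σ) := Real.rpow_le_rpow_of_nonpos h1 hy (by linarith)
  have h3 : 0 ≤ M ^ (-σ) := Real.rpow_nonneg (h1.le.trans hy) _
  exact mul_le_mul hc h2 h3 (norm_nonneg _)

lemma peetreMax_zero (σ r : ℝ) :
    peetreMax σ r (0 : EuclideanSpace ℝ (Fin d) → ℂ) = 0 := by
  ext x; simp [peetreMax]

lemma continuous_latticePeaks {n : ℕ} (a : EuclideanSpace ℝ (Fin d)) (τ : ℝ) (s : ℕ)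
    (u : Fin d → ZMod n) : Continuous (latticePeaks a τ s u) := by
  have : Continuous (dirichletMean n) := by unfold dirichletMean; fun_prop
  have h2 : Continuous (planeWave a) := by unfold planeWave; fun_prop
  unfold latticePeaks
  refine h2.mul ?_
  simp only [Finset.prod_fn]
  refine (continuous_finsetProd _ fun i _ => continuous_finsetProd _ fun _ _ => ?_)
  exact this.comp (by fun_prop)

/-- The average over the shifts of the mixed norms of localized lattices of peaks. -/
lemma sum_lintegral_latticePeaks_le {n L s : ℕ} [NeZero n] {p q : ℝ} (hp : 0 < p) (hq : 0 < q)
    (hL : L ≤ n ^ d) (hsq : 2 ≤ s * q) (a : Fin L → EuclideanSpace ℝ (Fin d)) (τ : Fin L → ℝ)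
    {ψ : EuclideanSpace ℝ (Fin d) → ℂ} (hψ : Continuous ψ) {ε : ℝ} (hε : 0 < ε) :
    ∑ ω : Fin L → Fin d → ZMod n, ∫⁻ x,
      (∑' k, ‖ψ (ε • x) * latticePeaks (a k) (τ k) s (ω k) x‖ₑ ^ q) ^ (p / q) ≤
    ENNReal.ofReal ((1 + (Nat.factorial ⌈p / q⌉₊ : ℝ)) * Real.exp 2 *
      Fintype.card (Fin L → Fin d → ZMod n)) *
      (ENNReal.ofReal ((ε ^ d)⁻¹) * ∫⁻ x, ‖ψ x‖ₑ ^ p) := by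
  rw [← lintegral_comp_smul_of_pos (F := fun x => ‖ψ x‖ₑ ^ p)
    (hψ.enorm.measurable.pow_const p) hε, ← lintegral_const_mul, ← lintegral_finsetSum]
  rotate_left
  · intro ω _
    refine Measurable.pow_const (Measurable.tsum fun k => Measurable.pow_const ?_ q) _
    exact ((hψ.comp (continuous_const_smul ε)).mul
      (continuous_latticePeaks _ _ _ _)).enorm.measurable
  · exact (hψ.comp (continuous_const_smul ε)).enorm.measurable.pow_const p
  refine lintegral_mono fun x => ?_
  set X : Fin L → (Fin d → ZMod n) → ℝ := fun k u => ‖latticePeaks (a k) (τ k) s u x‖ ^ q with hX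
  have hX0 : ∀ k u, 0 ≤ X k u := fun k u => by positivity
  have hpt : ∀ ω : Fin L → Fin d → ZMod n,
      (∑' k, ‖ψ (ε • x) * latticePeaks (a k) (τ k) s (ω k) x‖ₑ ^ q) ^ (p / q) =
        ENNReal.ofReal ((∑ k, X k (ω k)) ^ (p / q)) * ‖ψ (ε • x)‖ₑ ^ p := by
    intro ω
    rw [tsum_fintype]
    simp_rw [enorm_mul, ENNReal.mul_rpow_of_nonneg _ _ hq.le]
    rw [← Finset.mul_sum, ENNReal.mul_rpow_of_nonneg _ _ (by positivity), ← ENNReal.rpow_mul,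
      mul_div_cancel₀ _ hq.ne', mul_comm, ← ENNReal.ofReal_rpow_of_nonneg
        (Finset.sum_nonneg fun k _ => hX0 k (ω k)) (by positivity),
      ENNReal.ofReal_sum_of_nonneg fun k _ => hX0 k (ω k)]
    congr 2
    refine Finset.sum_congr rfl fun k _ => ?_
    rw [hX, ← ofReal_norm, ENNReal.ofReal_rpow_of_nonneg (norm_nonneg _) hq.le]
  simp_rw [hpt]
  rw [← Finset.sum_mul, ← ENNReal.ofReal_sum_of_nonneg fun ω _ =>
    Real.rpow_nonneg (Finset.sum_nonneg fun k _ => hX0 k (ω k)) _]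
  gcongr
  refine sum_rpow_sum_le X hX0 (fun k u => ?_) (fun k => ?_) ?_ (by positivity)
  · exact Real.rpow_le_one (norm_nonneg _) (norm_latticePeaks_le_one _ _ _ _ _) hq.le
  · exact sum_norm_latticePeaks_rpow_le n (a k) (τ k) hsq x
  · simpa [ZMod.card] using hL

/-- Test the supremum at the nearby peak. Since `1 + coordMax ≤ n`, `hn` keeps the scaled
displacement below `δ / 2`, so the envelope is still at least `c` at the peak. -/
lemma le_peetreMax_latticePeaks {n s : ℕ} [NeZero n] {σ r τ c δ ε : ℝ} (hσ : 0 ≤ σ) (hr : 0 < r)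
    (hτ : 0 < τ) (hε : 0 < ε) (a : EuclideanSpace ℝ (Fin d)) {ψ : EuclideanSpace ℝ (Fin d) → ℂ}
    (hψ : ∀ x, ‖x‖ ≤ δ → c ≤ ‖ψ x‖) (hn : ε * (d * n / τ) ≤ δ / 2)
    {x : EuclideanSpace ℝ (Fin d)} (hx : ‖ε • x‖ ≤ δ / 2) (u : Fin d → ZMod n) :
    ENNReal.ofReal (c * ((1 + d * (r / τ)) *
        (1 + coordMax fun i => u i - ((⌊τ * x i⌋ : ℤ) : ZMod n))) ^ (-σ)) ≤
      peetreMax σ r (fun x => ψ (ε • x) * latticePeaks a τ s u x) x := by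
  obtain ⟨y, hy1, hy⟩ := exists_norm_latticePeaks_eq_one a hτ s u x
  set V := coordMax fun i => u i - ((⌊τ * x i⌋ : ℤ) : ZMod n) with hV
  have hVn : 1 + V ≤ n := by
    have : V < n := (Finset.sup_lt_iff (Nat.pos_of_ne_zero (NeZero.ne n))).2
      fun i _ => ZMod.val_lt _
    omega
  refine ofReal_le_peetreMax hσ hr.le (y := y) ?_ ?_
  · rw [norm_mul, hy1, mul_one]
    refine hψ _ ?_
    rw [smul_add]
    refine (norm_add_le _ _).trans ?_
    have : ‖ε • y‖ ≤ δ / 2 := by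
      rw [norm_smul, Real.norm_of_nonneg hε.le]
      refine le_trans ?_ hn
      gcongr
      refine hy.trans ?_
      gcongr
      exact_mod_cast hVn
    linarith
  · have h1 : r * ‖y‖ ≤ d * (r / τ) * (1 + V) := by
      calc r * ‖y‖ ≤ r * (d * (1 + V) / τ) := by gcongr
        _ = _ := by ring
    have h2 : (0 : ℝ) ≤ V := Nat.cast_nonneg _
    nlinarith

/-- The average over the shifts of the mixed norms of the Peetre maximal functions. -/
lemma le_sum_lintegral_peetreMax {n L s : ℕ} [NeZero n] {p q σ c κ δ ε : ℝ}
    (hq : 0 < q) (hqp : q ≤ p) (hσ : 0 ≤ σ) (hL : n ^ d ≤ 2 ^ d * L) (hc : 0 < c) (hκ : 0 < κ)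
    {r τ : Fin L → ℝ} (hr : ∀ k, 0 < r k) (hrτ : ∀ k, r k / τ k = κ) (hτ : ∀ k, 0 < τ k)
    (a : Fin L → EuclideanSpace ℝ (Fin d)) {ψ : EuclideanSpace ℝ (Fin d) → ℂ}
    (hψc : Continuous ψ) (hψ : ∀ x, ‖x‖ ≤ δ → c ≤ ‖ψ x‖) (hε : 0 < ε)
    (hn : ∀ k, ε * (d * n / τ k) ≤ δ / 2) :
    ENNReal.ofReal (Fintype.card (Fin L → Fin d → ZMod n) *
        ((c * (1 + d * κ) ^ (-σ)) ^ q / 2 ^ d *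
          ∑ v : Fin d → ZMod n, (1 + (coordMax v : ℝ)) ^ (-(σ * q))) ^ (p / q)) *
      (ENNReal.ofReal ((ε ^ d)⁻¹) *
        volume (Metric.closedBall (0 : EuclideanSpace ℝ (Fin d)) (δ / 2))) ≤
    ∑ ω : Fin L → Fin d → ZMod n, ∫⁻ x,
      (∑' k, peetreMax σ (r k)
        (fun x => ψ (ε • x) * latticePeaks (a k) (τ k) s (ω k) x) x ^ q) ^ (p / q) := by
  have hball : MeasurableSet (Metric.closedBall (0 : EuclideanSpace ℝ (Fin d)) (δ / 2)) :=
    Metric.isClosed_closedBall.measurableSet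
  rw [← lintegral_indicator_one hball,
    ← lintegral_comp_smul_of_pos (measurable_one.indicator hball) hε,
    ← lintegral_const_mul, ← lintegral_finsetSum]
  rotate_left
  · intro ω _
    refine Measurable.pow_const (Measurable.tsum fun k => Measurable.pow_const ?_ q) _
    exact measurable_peetreMax (hr k).le
      ((hψc.comp (continuous_const_smul ε)).mul (continuous_latticePeaks _ _ _ _))
  · exact (measurable_one.indicator hball).comp (measurable_const_smul ε)
  refine lintegral_mono fun x => ?_
  by_cases hx : ε • x ∈ Metric.closedBall (0 : EuclideanSpace ℝ (Fin d)) (δ / 2)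
  swap
  · simp only [Set.indicator_of_notMem hx, mul_zero]
    exact zero_le
  rw [Set.indicator_of_mem hx, Pi.one_apply, mul_one]
  rw [mem_closedBall_zero_iff] at hx
  set c₁ := (c * (1 + d * κ) ^ (-σ)) ^ q with hc₁
  have hc₁0 : 0 ≤ c₁ := by positivity
  set S := ∑ v : Fin d → ZMod n, (1 + (coordMax v : ℝ)) ^ (-(σ * q)) with hS
  have hS0 : 0 ≤ S := Finset.sum_nonneg fun v _ => by positivity
  set Y : Fin L → (Fin d → ZMod n) → ℝ := fun k u =>
    c₁ * (1 + (coordMax fun i => u i - ((⌊τ k * x i⌋ : ℤ) : ZMod n) : ℝ)) ^ (-(σ * q)) with hY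
  have hY0 : ∀ k u, 0 ≤ Y k u := fun k u => by positivity
  have hYM : ∀ k u, ENNReal.ofReal (Y k u) ≤ peetreMax σ (r k)
      (fun x => ψ (ε • x) * latticePeaks (a k) (τ k) s u x) x ^ q := by
    intro k u
    have := ENNReal.rpow_le_rpow (le_peetreMax_latticePeaks (s := s) hσ (hr k) (hτ k) hε (a k) hψ
      (hn k) hx u) hq.le
    rw [hrτ, ENNReal.ofReal_rpow_of_nonneg (by positivity) hq.le] at this
    refine le_trans (ENNReal.ofReal_le_ofReal (le_of_eq ?_)) this
    rw [Real.mul_rpow (x := 1 + d * κ) (by positivity) (by positivity), ← mul_assoc,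
      Real.mul_rpow (x := c * _) (by positivity) (by positivity), ← Real.rpow_mul (by positivity),
      neg_mul]
  -- Subtracting the residues of the cell of `x` permutes the shifts, so the sum does not depend on
  -- `x` or on `k`.
  have hYsum : ∀ k, ∑ u, Y k u = c₁ * S := by
    intro k
    rw [hY, ← Finset.mul_sum, hS]
    congr 1
    exact (Equiv.subRight fun i => ((⌊τ k * x i⌋ : ℤ) : ZMod n)).sum_comp
      fun v => (1 + (coordMax v : ℝ)) ^ (-(σ * q))
  calc ENNReal.ofReal (Fintype.card (Fin L → Fin d → ZMod n) * (c₁ / 2 ^ d * S) ^ (p / q))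
      ≤ ENNReal.ofReal (∑ ω : Fin L → Fin d → ZMod n, (∑ k, Y k (ω k)) ^ (p / q)) := by
        refine ENNReal.ofReal_le_ofReal (le_sum_rpow_sum Y hY0 (by positivity) ?_
          ((one_le_div hq).2 hqp))
        simp_rw [hYsum]
        simp only [Finset.sum_const, Finset.card_univ, nsmul_eq_mul, Fintype.card_pi, ZMod.card,
          Finset.prod_const, Fintype.card_fin]
        have : ((n ^ d : ℕ) : ℝ) ≤ 2 ^ d * L := by exact_mod_cast hL
        calc c₁ / 2 ^ d * S * ((n ^ d : ℕ) : ℝ) ≤ c₁ / 2 ^ d * S * (2 ^ d * L) := by gcongr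
          _ = _ := by field_simp
    _ = ∑ ω : Fin L → Fin d → ZMod n, (∑ k, ENNReal.ofReal (Y k (ω k))) ^ (p / q) := by
        rw [ENNReal.ofReal_sum_of_nonneg fun ω _ =>
          Real.rpow_nonneg (Finset.sum_nonneg fun k _ => hY0 k (ω k)) _]
        refine Finset.sum_congr rfl fun ω _ => ?_
        rw [← ENNReal.ofReal_rpow_of_nonneg (Finset.sum_nonneg fun k _ => hY0 k (ω k))
          (div_nonneg (hq.le.trans hqp) hq.le),
          ENNReal.ofReal_sum_of_nonneg fun k _ => hY0 k (ω k)]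
    _ ≤ _ := by
        refine Finset.sum_le_sum fun ω _ => ?_
        rw [tsum_fintype]
        refine ENNReal.rpow_le_rpow (Finset.sum_le_sum fun k _ => hYM k (ω k))
          (div_nonneg (hq.le.trans hqp) hq.le)

end PeetreMaximalFunction

/-! ### Choice of the period and the resulting growth in `L` -/

section Parameters

lemma exists_pow_between {d L : ℕ} (hd : 0 < d) (hL : 1 ≤ L) :
    ∃ n : ℕ, n ≠ 0 ∧ L ≤ n ^ d ∧ n ^ d ≤ 2 ^ d * L := by
  have hex : ∃ n : ℕ, L ≤ n ^ d := ⟨L, Nat.le_self_pow hd.ne' L⟩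
  classical
  refine ⟨Nat.find hex, fun h => ?_, Nat.find_spec hex, ?_⟩
  · have := Nat.find_spec hex
    rw [h, zero_pow hd.ne'] at this
    omega
  · obtain ⟨m, hm⟩ : ∃ m, Nat.find hex = m + 1 := Nat.exists_eq_succ_of_ne_zero fun h => by
      have := Nat.find_spec hex
      rw [h, zero_pow hd.ne'] at this
      omega
    have hmin : m ^ d < L := not_le.1 (Nat.find_min hex (by omega))
    rw [hm]
    rcases Nat.eq_zero_or_pos m with rfl | hmpos
    · simpa using Nat.mul_le_mul (Nat.one_le_pow d 2 (by norm_num)) hL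
    · calc (m + 1) ^ d ≤ (2 * m) ^ d := Nat.pow_le_pow_left (by omega) d
        _ = 2 ^ d * m ^ d := mul_pow 2 m d
        _ ≤ _ := Nat.mul_le_mul_left _ hmin.le

/-- Converts the two lattice-sum bounds from `n` to `L` by means of `L ≤ n ^ d`. The factor `d`
comes from `log L ≤ d * log n`. -/
lemma max_rpow_le_sum_coordMax {d n L : ℕ} [NeZero n] (hd : 0 < d) (hL1 : 1 ≤ L) (hL : L ≤ n ^ d)
    {q σ : ℝ} (hq : 0 < q) (hσ0 : 0 ≤ σ) (hσ : σ ≤ d / q) :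
    max ((L : ℝ) ^ (1 / q - σ / d)) ((Real.log L) ^ (1 / q)) ^ q ≤
      d * ∑ v : Fin d → ZMod n, (1 + (coordMax v : ℝ)) ^ (-(σ * q)) := by
  have hdR : (0 : ℝ) < d := by exact_mod_cast hd
  have hd1 : (1 : ℝ) ≤ d := by exact_mod_cast hd
  have hLR : (1 : ℝ) ≤ L := by exact_mod_cast hL1
  have hLn : (L : ℝ) ≤ (n : ℝ) ^ d := by exact_mod_cast hL
  have hσq : σ * q ≤ d := by rwa [le_div_iff₀ hq] at hσ
  have hS := rpow_le_sum_coordMax d n (mul_nonneg hσ0 hq.le)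
  have hS' := log_le_sum_coordMax hd n hσq
  rcases max_choice ((L : ℝ) ^ (1 / q - σ / d)) ((Real.log L) ^ (1 / q)) with h | h <;> rw [h]
  · rw [← Real.rpow_mul (by positivity)]
    have hexp : (1 / q - σ / d) * q = 1 - σ * q / d := by field_simp
    have hexp0 : 0 ≤ 1 - σ * q / d := by
      rw [sub_nonneg, div_le_one hdR]; exact hσq
    calc (L : ℝ) ^ ((1 / q - σ / d) * q) ≤ ((n : ℝ) ^ d) ^ (1 - σ * q / d) := by
          rw [hexp]; gcongr
      _ = (n : ℝ) ^ ((d : ℝ) - σ * q) := by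
          rw [← Real.rpow_natCast, ← Real.rpow_mul (by positivity)]
          congr 1; field_simp
      _ ≤ _ := hS.trans (le_mul_of_one_le_left (le_trans (by positivity) hS) hd1)
  · have hlog : 0 ≤ Real.log L := Real.log_nonneg hLR
    rw [← Real.rpow_mul hlog, one_div_mul_cancel hq.ne', Real.rpow_one]
    calc Real.log L ≤ Real.log ((n : ℝ) ^ d) := Real.log_le_log (by linarith) hLn
      _ = d * Real.log n := by rw [Real.log_pow]
      _ ≤ _ := by gcongr

end Parameters

/-! ### The lower bound for finite families -/

section SharpLowerBound

variable {d : ℕ}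

lemma mixedNorm_ne_zero {ι : Type} [Countable ι] {p q : ℝ} (hp : 0 < p) (hq : 0 < q)
    {f : ι → EuclideanSpace ℝ (Fin d) → ℂ} (hf : ∀ k, Continuous (f k)) {k : ι} (hk : f k ≠ 0) :
    mixedNorm p q (fun k x => ‖f k x‖ₑ) ≠ 0 := by
  intro h
  rw [mixedNorm_eq_lintegral hp, ENNReal.rpow_eq_zero_iff_of_pos (by positivity),
    lintegral_eq_zero_iff (Measurable.pow_const
      (Measurable.tsum fun k => (hf k).enorm.measurable.pow_const q) _)] at h
  apply hk
  refine (Continuous.ae_eq_iff_eq volume (hf k) (continuous_zero (X := EuclideanSpace ℝ (Fin d)))).1 ?_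
  filter_upwards [h] with x hx
  rw [Pi.zero_apply, ENNReal.rpow_eq_zero_iff_of_pos (div_pos hp hq), ENNReal.tsum_eq_zero] at hx
  simpa [hq] using hx k

/-- The sharp lower bound for the vector-valued Peetre maximal inequality. -/
theorem exists_mixedNorm_le_peetreMax (hd : 0 < d) {p q σ : ℝ} (hq : 0 < q) (hqp : q ≤ p)
    (hσ0 : 0 ≤ σ) (hσ : σ ≤ d / q) :
    ∃ c : ℝ, 0 < c ∧ ∀ L : ℕ, 1 ≤ L → ∀ r : Fin L → ℝ, (∀ k, 0 < r k) →
      ∃ f : Fin L → EuclideanSpace ℝ (Fin d) → ℂ,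
        (∀ k, SchwartzSpectrumIn
          {ξ | r k / (4 * Real.pi) ≤ ‖ξ‖ ∧ ‖ξ‖ ≤ r k / (2 * Real.pi)} (f k)) ∧
        (∃ k, f k ≠ 0) ∧
        mixedNorm p q (fun k x => ‖f k x‖ₑ) ≠ ∞ ∧
        ENNReal.ofReal (c * max ((L : ℝ) ^ (1 / q - σ / d)) ((Real.log L) ^ (1 / q))) *
            mixedNorm p q (fun k x => ‖f k x‖ₑ) ≤
          mixedNorm p q (fun k x => peetreMax σ (r k) (f k) x) := by
  have hp : 0 < p := hq.trans_le hqp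
  have hpi := Real.pi_pos
  have hdR : (0 : ℝ) < d := by exact_mod_cast hd
  obtain ⟨ψ, hψs, c₀, hc₀, δ, hδ, hψ⟩ := exists_schwartz_spectrum_unitBall d
  have hψc : Continuous ψ := hψs.continuous
  have hG : ∫⁻ x, ‖ψ x‖ₑ ^ p ≠ ∞ := by
    have := (lintegral_rpow_enorm_lt_top_of_eLpNorm_lt_top (by simpa using hp)
      ENNReal.ofReal_ne_top (hψs.memLp (ENNReal.ofReal p)).2).ne
    rwa [ENNReal.toReal_ofReal hp.le] at this
  set G := (∫⁻ x, ‖ψ x‖ₑ ^ p).toReal with hGdef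
  have hG0 : 0 ≤ G := ENNReal.toReal_nonneg
  have hV : volume (Metric.closedBall (0 : EuclideanSpace ℝ (Fin d)) (δ / 2)) ≠ ∞ :=
    (isCompact_closedBall _ _).measure_ne_top
  set V := (volume (Metric.closedBall (0 : EuclideanSpace ℝ (Fin d)) (δ / 2))).toReal with hVdef
  have hV0 : 0 < V := ENNReal.toReal_pos (Metric.measure_closedBall_pos _ _ (by positivity)).ne' hV
  set s : ℕ := ⌈2 / q⌉₊ with hs
  have hsq : 2 ≤ s * q := by
    rw [← div_le_iff₀ hq]
    exact Nat.le_ceil _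
  have hs0 : (0 : ℝ) < s := by
    by_contra h
    nlinarith
  -- With `ρ = r k / (2π)` and `τ k = r k / κ`, the peaks have spectral radius `d * s * τ k = ρ /
  -- 16`. The envelope adds at most `ρ / 16`, so around a centre of norm `3ρ/4` the spectrum stays
  -- in `[5ρ/8, 7ρ/8]`, inside the annulus.
  set κ : ℝ := 2 * Real.pi * (16 * d * s) with hκdef
  have hκ : 0 < κ := by positivity
  set D : ℝ := (1 + (Nat.factorial ⌈p / q⌉₊ : ℝ)) * Real.exp 2 with hD
  set c₂ : ℝ := (c₀ * (1 + d * κ) ^ (-σ)) ^ q / 2 ^ d / d with hc₂def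
  have hc₂ : 0 < c₂ := by positivity
  -- The ratio of the lower to the upper average; the `+ 1` keeps the denominator positive without
  -- requiring `G > 0`.
  set E : ℝ := c₂ ^ (p / q) * V / (D * G + 1) with hE
  have hE0 : 0 < E := by positivity
  refine ⟨E ^ (1 / p), by positivity, fun L hL r hr => ?_⟩
  obtain ⟨n, hn0, hLn, hnL⟩ := exists_pow_between hd hL
  have : NeZero n := ⟨hn0⟩
  have hnpos : (0 : ℝ) < n := by exact_mod_cast Nat.pos_of_ne_zero hn0
  set τ : Fin L → ℝ := fun k => r k / κ with hτdef
  have hτ : ∀ k, 0 < τ k := fun k => div_pos (hr k) hκ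
  have hrτ : ∀ k, r k / τ k = κ := fun k => by
    have := (hr k).ne'
    simp only [hτdef]; field_simp
  obtain ⟨ε, hε, hε1⟩ : ∃ ε : ℝ, 0 < ε ∧
      ∀ k, ε ≤ min (r k / (2 * Real.pi) / 16) (δ / 2 * τ k / (d * n)) := by
    have h1 : ∀ᶠ ε : ℝ in nhdsWithin 0 (Set.Ioi 0),
        ∀ k, ε ≤ min (r k / (2 * Real.pi) / 16) (δ / 2 * τ k / (d * n)) := by
      rw [Filter.eventually_all]
      intro k
      have hk := hr k
      have hk' := hτ k
      filter_upwards [Ioc_mem_nhdsGT (lt_min (by positivity : 0 < r k / (2 * Real.pi) / 16)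
        (by positivity : 0 < δ / 2 * τ k / (d * n)))] with ε hε
      exact hε.2
    obtain ⟨ε, h2, h3⟩ := (h1.and self_mem_nhdsWithin).exists
    exact ⟨ε, h3, h2⟩
  have hεn : ∀ k, ε * (d * n / τ k) ≤ δ / 2 := by
    intro k
    have h1 := (hε1 k).trans (min_le_right _ _)
    rw [le_div_iff₀ (by positivity)] at h1
    rw [mul_div_assoc', div_le_iff₀ (hτ k)]
    exact h1
  set a : Fin L → EuclideanSpace ℝ (Fin d) := fun k =>
    EuclideanSpace.single ⟨0, hd⟩ (3 / 4 * (r k / (2 * Real.pi))) with ha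
  have hspec : ∀ (k : Fin L) (u : Fin d → ZMod n), SchwartzSpectrumIn
      {ξ | r k / (4 * Real.pi) ≤ ‖ξ‖ ∧ ‖ξ‖ ≤ r k / (2 * Real.pi)}
      (fun x => ψ (ε • x) * latticePeaks (a k) (τ k) s u x) := by
    intro k u
    refine hψs.comp_smul_mul_trigPoly hε (fun b hb ξ hξ => ?_)
      (latticePeaks_mem_trigPoly (a k) (τ k) s u)
    rw [mem_closedBall_iff_norm] at hb hξ
    set ρ := r k / (2 * Real.pi) with hρ
    have hρ0 : 0 < ρ := by have := hr k; positivity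
    have hb' : ‖b - a k‖ ≤ ρ / 16 := by
      refine hb.trans (le_of_eq ?_)
      rw [abs_of_pos (hτ k), hρ]
      simp only [hτdef, hκdef]
      field_simp
    have hξ' : ‖ξ - b‖ ≤ ρ / 16 := hξ.trans ((hε1 k).trans (min_le_left _ _))
    have hak : ‖a k‖ = 3 / 4 * ρ := by
      simp only [ha]
      rw [PiLp.norm_single, Real.norm_of_nonneg (by positivity)]
    have hdist : ‖ξ - a k‖ ≤ ρ / 8 := by
      calc ‖ξ - a k‖ = ‖(ξ - b) + (b - a k)‖ := by rw [sub_add_sub_cancel]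
        _ ≤ _ := (norm_add_le _ _).trans (by linarith)
    have h1 := norm_sub_norm_le ξ (a k)
    have h2 := norm_sub_norm_le (a k) ξ
    rw [norm_sub_rev] at h2
    have h4 : r k / (4 * Real.pi) = ρ / 2 := by rw [hρ]; field_simp; norm_num
    rw [Set.mem_ofPred_eq, h4]
    constructor <;> linarith
  set A := max ((L : ℝ) ^ (1 / q - σ / d)) ((Real.log L) ^ (1 / q)) with hA
  have hA0 : 0 ≤ A := le_max_of_le_left (by positivity)
  set N : ℝ := (Fintype.card (Fin L → Fin d → ZMod n) : ℝ) with hN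
  have hN0 : 0 ≤ N := Nat.cast_nonneg _
  have hupper := sum_lintegral_latticePeaks_le hp hq hLn hsq a τ hψc hε
  have hlower := le_sum_lintegral_peetreMax (s := s) hq hqp hσ0 hnL hc₀ hκ hr hrτ hτ a hψc hψ hε hεn
  have hSA := max_rpow_le_sum_coordMax (n := n) hd hL hLn hq hσ0 hσ
  set S := ∑ v : Fin d → ZMod n, (1 + (coordMax v : ℝ)) ^ (-(σ * q)) with hS
  have hpos : 0 ≤ (ε ^ d)⁻¹ := by positivity
  rw [← ENNReal.ofReal_toReal hG, ← hGdef, ← ENNReal.ofReal_mul hpos,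
    ← ENNReal.ofReal_mul (by positivity)] at hupper
  rw [← ENNReal.ofReal_toReal hV, ← hVdef, ← ENNReal.ofReal_mul hpos,
    ← ENNReal.ofReal_mul (by positivity)] at hlower
  have hmain : ∑ ω : Fin L → Fin d → ZMod n, ENNReal.ofReal (E * A ^ p) * ∫⁻ x,
      (∑' k, ‖ψ (ε • x) * latticePeaks (a k) (τ k) s (ω k) x‖ₑ ^ q) ^ (p / q) ≤
      ∑ ω : Fin L → Fin d → ZMod n, ∫⁻ x, (∑' k, peetreMax σ (r k)
        (fun x => ψ (ε • x) * latticePeaks (a k) (τ k) s (ω k) x) x ^ q) ^ (p / q) := by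
    rw [← Finset.mul_sum]
    refine le_trans (mul_le_mul_right hupper _) (le_trans ?_ hlower)
    rw [← ENNReal.ofReal_mul (by positivity)]
    refine ENNReal.ofReal_le_ofReal ?_
    have hAp : c₂ ^ (p / q) * A ^ p ≤
        ((c₀ * (1 + d * κ) ^ (-σ)) ^ q / 2 ^ d * S) ^ (p / q) := by
      have h1 : A ^ p = (A ^ q) ^ (p / q) := by
        rw [← Real.rpow_mul hA0, mul_div_cancel₀ _ hq.ne']
      rw [h1, ← Real.mul_rpow hc₂.le (by positivity)]
      refine Real.rpow_le_rpow (by positivity) ?_ (by positivity)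
      calc c₂ * A ^ q ≤ c₂ * (d * S) := by gcongr
        _ = _ := by rw [hc₂def]; field_simp
    have hEG : E * (D * G) ≤ c₂ ^ (p / q) * V := by
      rw [hE, div_mul_eq_mul_div]
      refine div_le_of_le_mul₀ (by positivity) (by positivity) ?_
      gcongr
      linarith
    calc E * A ^ p * (D * N * ((ε ^ d)⁻¹ * G))
        = E * (D * G) * (A ^ p * N * (ε ^ d)⁻¹) := by ring
      _ ≤ c₂ ^ (p / q) * V * (A ^ p * N * (ε ^ d)⁻¹) := by gcongr
      _ = N * (c₂ ^ (p / q) * A ^ p) * ((ε ^ d)⁻¹ * V) := by ring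
      _ ≤ _ := by gcongr
  -- If the inequality failed for every choice of shifts, it would fail for the sum.
  obtain ⟨ω, -, hω⟩ := ENNReal.exists_le_of_sum_le Finset.univ_nonempty hmain
  refine ⟨fun k x => ψ (ε • x) * latticePeaks (a k) (τ k) s (ω k) x, fun k => hspec k (ω k),
    ⟨⟨0, hL⟩, fun h0 => ?_⟩, ?_, ?_⟩
  -- The first function is nonzero because its maximal function is positive at the origin.
  · have h1 := le_peetreMax_latticePeaks (s := s) hσ0 (hr ⟨0, hL⟩) (hτ ⟨0, hL⟩) hε (a ⟨0, hL⟩) hψ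
      (hεn ⟨0, hL⟩) (x := 0) (by simpa using by positivity) (ω ⟨0, hL⟩)
    beta_reduce at h0
    rw [h0, peetreMax_zero, Pi.zero_apply, nonpos_iff_eq_zero, ENNReal.ofReal_eq_zero] at h1
    refine absurd h1 (not_le.2 ?_)
    have := hτ ⟨0, hL⟩
    have := hr ⟨0, hL⟩
    positivity
  · rw [mixedNorm_eq_lintegral hp]
    refine ENNReal.rpow_ne_top_of_nonneg (by positivity) (ne_top_of_le_ne_top ENNReal.ofReal_ne_top
      (le_trans ?_ hupper))
    exact Finset.single_le_sum (f := fun ω : Fin L → Fin d → ZMod n => ∫⁻ x,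
      (∑' k, ‖ψ (ε • x) * latticePeaks (a k) (τ k) s (ω k) x‖ₑ ^ q) ^ (p / q))
      (fun _ _ => zero_le) (Finset.mem_univ ω)
  · rw [mixedNorm_eq_lintegral hp, mixedNorm_eq_lintegral hp]
    have h1 : E ^ (1 / p) * A = (E * A ^ p) ^ (1 / p) := by
      rw [Real.mul_rpow hE0.le (by positivity), ← Real.rpow_mul hA0, mul_one_div_cancel hp.ne',
        Real.rpow_one]
    rw [h1, ← ENNReal.ofReal_rpow_of_nonneg (by positivity) (by positivity),
      ← ENNReal.mul_rpow_of_nonneg _ _ (by positivity)]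
    exact ENNReal.rpow_le_rpow hω (by positivity)

end SharpLowerBound

/-! ### Passage to sequences and the main theorem -/

/-- Extending a finite family by zero does not change the mixed norm. -/
lemma mixedNorm_extend_fin {d L : ℕ} {p q : ℝ} (hq : 0 < q)
    {F : ℕ → EuclideanSpace ℝ (Fin d) → ℝ≥0∞} (hF : ∀ k, L ≤ k → F k = 0) :
    mixedNorm p q F = mixedNorm p q (fun k : Fin L => F k) := by
  unfold mixedNorm
  congr 1
  ext x
  rw [tsum_fintype (L := .unconditional (Fin L)), Fin.sum_univ_eq_sum_range (fun k => F k x ^ q) L,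
    tsum_eq_sum (s := Finset.range L)]
  intro k hk
  rw [hF k (by simpa using hk), Pi.zero_apply, ENNReal.zero_rpow_of_pos hq]

theorem theorem1p2 (d : ℕ) (hd : 0 < d) (p q σ : ℝ) (hq : 0 < q) (hqp : q ≤ p)
    (hσ0 : 0 ≤ σ) (hσ : σ ≤ d / q) :
    (∃ c : ℝ, 0 < c ∧ ∀ r : ℕ → ℝ, (∀ k, 0 < r k) → ∀ L : ℕ, 1 ≤ L →
      ∃ f : Fin L → EuclideanSpace ℝ (Fin d) → ℂ,
        (∀ k : Fin L, f k ∈ expTypeAnnulus d (r k) ∧ MemLp (f k) (ENNReal.ofReal p) volume) ∧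
        (∃ k, f k ≠ 0) ∧
        ENNReal.ofReal (c * max ((L : ℝ) ^ (1 / q - σ / d)) ((Real.log L) ^ (1 / q))) *
            mixedNorm p q (fun k x => ‖f k x‖ₑ) ≤
          mixedNorm p q (fun (k : Fin L) x => peetreMax σ (r k) (f k) x)) ∧
    (∀ r : ℕ → ℝ, (∀ k, 0 < r k) →
      ¬ ∃ C : ℝ≥0, ∀ f : ℕ → EuclideanSpace ℝ (Fin d) → ℂ,
        (∀ k, f k ∈ expTypeAnnulus d (r k) ∧ MemLp (f k) (ENNReal.ofReal p) volume) →
        mixedNorm p q (fun k x => peetreMax σ (r k) (f k) x) ≤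
          C * mixedNorm p q (fun k x => ‖f k x‖ₑ)) := by
  have hp : 0 < p := hq.trans_le hqp
  obtain ⟨c, hc, H⟩ := exists_mixedNorm_le_peetreMax hd hq hqp hσ0 hσ
  refine ⟨⟨c, hc, fun r hr L hL => ?_⟩, fun r hr ⟨C, hC⟩ => ?_⟩
  · obtain ⟨f, hf, hf0, -, hle⟩ := H L hL (fun k => r k) fun k => hr k
    exact ⟨f, fun k => ⟨(hf k).mem_expTypeAnnulus, (hf k).memLp _⟩, hf0, hle⟩
  -- The logarithmic term alone is unbounded, so it rules out every `C` even at the endpoint `σ = d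
  -- / q`.
  · have hlim : Filter.Tendsto (fun L : ℕ => c * (Real.log L) ^ (1 / q)) Filter.atTop
        Filter.atTop :=
      ((tendsto_rpow_atTop (one_div_pos.2 hq)).comp
        (Real.tendsto_log_atTop.comp tendsto_natCast_atTop_atTop)).const_mul_atTop hc
    obtain ⟨L, hLC, hL⟩ := ((hlim.eventually_gt_atTop (C : ℝ)).and
      (Filter.eventually_ge_atTop 1)).exists
    obtain ⟨f, hf, ⟨k₀, hk₀⟩, hfin, hle⟩ := H L hL (fun k => r k) fun k => hr k
    let g : ℕ → EuclideanSpace ℝ (Fin d) → ℂ := fun k => if h : k < L then f ⟨k, h⟩ else 0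
    have hgf : ∀ k : Fin L, g k = f k := fun k => dif_pos k.2
    have hg0 : ∀ k, L ≤ k → g k = 0 := fun k hk => dif_neg (not_lt.2 hk)
    have hg := hC g fun k => by
      by_cases h : k < L
      · rw [show g k = f ⟨k, h⟩ from dif_pos h]
        exact ⟨(hf ⟨k, h⟩).mem_expTypeAnnulus, (hf ⟨k, h⟩).memLp _⟩
      · rw [show g k = 0 from dif_neg h]
        exact ⟨SchwartzSpectrumIn.zero.mem_expTypeAnnulus, SchwartzSpectrumIn.zero.memLp (S := ∅) _⟩
    rw [mixedNorm_extend_fin (L := L) hq fun k hk => by rw [hg0 k hk, peetreMax_zero],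
      mixedNorm_extend_fin (L := L) hq fun k hk => by ext x; simp [hg0 k hk]] at hg
    simp only [hgf] at hg
    have hne := mixedNorm_ne_zero hp hq (fun k => (hf k).continuous) hk₀
    -- The mixed norm of the `f k` can be cancelled only because it is neither `0` nor `∞`.
    have h1 := (ENNReal.mul_le_mul_iff_left hne hfin).1 (hle.trans hg)
    rw [← ENNReal.ofReal_coe_nnreal] at h1
    have h1 := (ENNReal.ofReal_le_ofReal_iff C.coe_nonneg).1 h1
    have h2 : c * (Real.log L) ^ (1 / q) ≤
        c * max ((L : ℝ) ^ (1 / q - σ / d)) ((Real.log L) ^ (1 / q)) := by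
      gcongr
      exact le_max_right _ _
    linarith
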